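/- Let $h(t)$, $t\in\mathbb R$, be a stationary Rayleigh flat fading channel of unit power, i.e. a zero-mean, circularly symmetric complex Gaussian process with $\mathbb E[h(t)h^\star(t-\tau)]=\rho_h(\tau)$ for all $t,\tau$ and $\mathbb E|h(t)|^2=\rho_h(0)=1$. Let $T_s>0$ be the symbol duration, $\eta>0$ the average SNR, $\varrho_1=|\rho_h(T_s)|<1$, and let $\mathcal I_{\rm th}\ge 0$ be a threshold. Let $\alpha_l=|h(lT_s)|$ and let $\mathcal I_l=\log_2(1+\eta\alpha_l^2)$, $l=1,2,\dots$, be the instantaneous mutual information (IMI) of the SISO system; put $X_l=1$ if $\mathcal I_l\ge\mathcal I_{\rm th}$ and $X_l=0$ otherwise. For $L\ge2$ let the level-crossing rate $N_{\mathcal I}(\mathcal I_{\rm th})$ be the expected number of down-crossings (indices $2\le l\le L$ with $X_{l-1}=1$, $X_l=0$) divided by $(L-1)T_s$, and let the average outage duration $\bar t_{\mathcal I}(\mathcal I_{\rm th})$ be the expected time spent in outage, $T_s\,\mathbb E\,\#\{2\le l\le L:\mathcal I_l<\mathcal I_{\rm th}\}$, divided by the expected number of down-crossings. Write $\Gamma(a,z)=\int_z^\infty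 t^{a-1}e^{-t}\,dt$. (1) For every $L\ge2$ and every $l\ge2$, $$N_{\mathcal I}(\mathcal I_{\rm th})=\frac{\mathbb E\big[\sum_{j=2}^L(X_j-X_{j-1})^2\big]}{2(L-1)T_s}=\frac{\Pr\{X_l=1\}-\Pr\{X_l=1,X_{l-1}=1\}}{T_s}$$ $$=\frac{1}{T_s}\left(e^{-\frac{2^{\mathcal I_{\rm th}}-1}{\eta}}-(1-\varrho_1^2)\sum_{k=0}^\infty\left[\frac{\varrho_1^k}{k!}\,\Gamma\!\left(k+1,\frac{2^{\mathcal I_{\rm th}}-1}{\eta(1-\varrho_1^2)}\right)\right]^2\right),$$ and the series converges. (2) For every $l\ge1$ the cumulative distribution function of $\mathcal I_l$ satisfies $F_{\mathcal I}(\mathcal I_{\rm th})=\Pr\{\mathcal I_l\le\mathcal I_{\rm th}\}=1-e^{-(2^{\mathcal I_{\rm th}}-1)/\eta}$. (3) If $\mathcal I_{\rm th}>0$, then $N_{\mathcal I}(\mathcal I_{\rm th})>0$ and, for every $L\ge2$, the average outage duration normalized by $T_s$ is $$\frac{\bar t_{\mathcal I}(\mathcal I_{\rm th})}{T_s}=\frac{F_{\mathcal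 I}(\mathcal I_{\rm th})}{T_sN_{\mathcal I}(\mathcal I_{\rm th})}=\frac{1-e^{-\frac{2^{\mathcal I_{\rm th}}-1}{\eta}}}{e^{-\frac{2^{\mathcal I_{\rm th}}-1}{\eta}}-(1-\varrho_1^2)\sum_{k=0}^\infty\left[\frac{\varrho_1^k}{k!}\,\Gamma\!\left(k+1,\frac{2^{\mathcal I_{\rm th}}-1}{\eta(1-\varrho_1^2)}\right)\right]^2}.$$ -/

import Mathlib

open MeasureTheory ProbabilityTheory

noncomputable section

namespace SISO

/-- The upper incomplete gamma function `Γ(a, z) = ∫_z^∞ t^(a-1) e^(-t) dt`. -/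
def upperGamma (a z : ℝ) : ℝ := ∫ t in Set.Ioi z, t ^ (a - 1) * Real.exp (-t)

/-- `h` is a stationary Rayleigh flat fading channel of unit power with correlation
coefficient `ρ`: a zero-mean circularly symmetric complex Gaussian random process with
`E[h(t) h(t - τ)^*] = ρ(τ)` and `E[|h(t)|^2] = ρ(0) = 1`. -/
structure IsRayleighChannel {Ω : Type*} [MeasurableSpace Ω] (μ : Measure Ω)
    (h : ℝ → Ω → ℂ) (ρ : ℝ → ℂ) : Prop where
  /-- all finite families of real and imaginary parts of samples are jointly Gaussian -/
  gaussian : IsGaussianProcess h μ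
  zero_mean : ∀ t, ∫ ω, h t ω ∂μ = 0
  /-- circular symmetry: the pseudo-covariance vanishes -/
  circular : ∀ s t, ∫ ω, h s ω * h t ω ∂μ = 0
  correlation : ∀ t τ, ∫ ω, h t ω * (starRingEnd ℂ) (h (t - τ) ω) ∂μ = ρ τ
  unit_power : ρ 0 = 1

variable {Ω : Type*}

/-- The envelope `α_l = |h(l Ts)|` of the `l`-th sample of the channel. -/
def envelope (h : ℝ → Ω → ℂ) (Ts : ℝ) (l : ℕ) (ω : Ω) : ℝ := ‖h (l * Ts) ω‖

/-- The instantaneous mutual information `I_l = log₂ (1 + η α_l²)`. -/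
def imi (h : ℝ → Ω → ℂ) (Ts η : ℝ) (l : ℕ) (ω : Ω) : ℝ :=
  Real.logb 2 (1 + η * envelope h Ts l ω ^ 2)

open Classical in
/-- The binary sequence `X_l`: `1` if `I_l ≥ Ith`, and `0` if `I_l < Ith`. -/
def binary (h : ℝ → Ω → ℂ) (Ts η Ith : ℝ) (l : ℕ) (ω : Ω) : ℝ :=
  if Ith ≤ imi h Ts η l ω then 1 else 0

/-- The number of (up- and down-) crossings of the level `Ith` among the samples
`1, …, L`. -/
def crossings (h : ℝ → Ω → ℂ) (Ts η Ith : ℝ) (L : ℕ) (ω : Ω) : ℝ :=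
  ∑ l ∈ Finset.Icc 2 L, (binary h Ts η Ith l ω - binary h Ts η Ith (l - 1) ω) ^ 2

open Classical in
/-- The number of down-crossings among the samples `1, …, L`: the number of
`l ∈ {2, …, L}` with `X_{l-1} = 1` and `X_l = 0`. -/
def downCrossings (h : ℝ → Ω → ℂ) (Ts η Ith : ℝ) (L : ℕ) (ω : Ω) : ℕ :=
  ((Finset.Icc 2 L).filter
    fun l => binary h Ts η Ith (l - 1) ω = 1 ∧ binary h Ts η Ith l ω = 0).card

open Classical in
/-- The time spent in outage (`I_l < Ith`) by the symbols `l = 2, …, L`,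
each of duration `Ts`. -/
def outageTime (h : ℝ → Ω → ℂ) (Ts η Ith : ℝ) (L : ℕ) (ω : Ω) : ℝ :=
  Ts * (((Finset.Icc 2 L).filter fun l => imi h Ts η l ω < Ith).card : ℝ)

variable [MeasurableSpace Ω]

/-- The expected rate (per unit time) of all crossings of the level `Ith`, over `L` samples. -/
def crossingRate (μ : Measure Ω) (h : ℝ → Ω → ℂ) (Ts η Ith : ℝ) (L : ℕ) : ℝ :=
  (∫ ω, crossings h Ts η Ith L ω ∂μ) / (((L : ℝ) - 1) * Ts)

/-- The level-crossing rate: the expected rate (per unit time) of down-crossings of the level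
`Ith`, over `L` samples. -/
def lcr (μ : Measure Ω) (h : ℝ → Ω → ℂ) (Ts η Ith : ℝ) (L : ℕ) : ℝ :=
  (∫ ω, (downCrossings h Ts η Ith L ω : ℝ) ∂μ) / (((L : ℝ) - 1) * Ts)

/-- The average outage duration: the expected time spent in outage divided by the expected
number of outages (down-crossings), over `L` samples. -/
def aod (μ : Measure Ω) (h : ℝ → Ω → ℂ) (Ts η Ith : ℝ) (L : ℕ) : ℝ :=
  (∫ ω, outageTime h Ts η Ith L ω ∂μ) / ∫ ω, (downCrossings h Ts η Ith L ω : ℝ) ∂μ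

/-- The cumulative distribution function of `I_l`. -/
def imiCDF (μ : Measure Ω) (h : ℝ → Ω → ℂ) (Ts η : ℝ) (l : ℕ) (x : ℝ) : ℝ :=
  μ.real {ω | imi h Ts η l ω ≤ x}

end SISO

end

/-!
Split the second of two consecutive samples `A`, `B` as `B = r A + W` with `r = E[B A^*]`. The
innovation `W` is uncorrelated with `A`, hence independent of it, so given `A` the power `‖B‖²` is
noncentral chi-square: a Poisson mixture of gamma laws whose Poisson mean is proportional to
`‖A‖²`. Since `‖A‖²` is exponential, weighting its law by the Poisson probabilities again gives
gamma laws, with geometric total masses. Thus `(‖A‖², ‖B‖²)` is a geometric mixture of products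
of gamma laws, and its joint tail is the series of squared incomplete gamma functions.

By stationarity a given step is an up-crossing and a down-crossing with the same probability
`Pr{X_l = 1} - Pr{X_l = 1, X_{l-1} = 1}`, which is positive at a positive threshold because the
mixture charges every rectangle of positive area in the quadrant.
-/

open Set
open scoped Real ENNReal ComplexConjugate

section CircleIntegral

lemma intervalIntegral_cexp_circleMap_mul_inv_pow (ζ : ℂ) (k : ℕ) :
    ∫ θ in 0..2 * π, Complex.exp (ζ * circleMap 0 1 θ) * (circleMap 0 1 θ)⁻¹ ^ k =
      2 * π * (ζ ^ k / k.factorial) := by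
  have hdiff : Differentiable ℂ fun z : ℂ => Complex.exp (ζ * z) := by fun_prop
  have hcauchy := (hdiff.diffContOnCl (s := Metric.ball 0 1)
    ).circleIntegral_one_div_sub_center_pow_smul one_pos k
  have hderiv : iteratedDeriv k (fun z : ℂ => Complex.exp (ζ * z)) 0 = ζ ^ k := by simp
  have hintegrand (θ : ℝ) : deriv (circleMap 0 1) θ • (1 / (circleMap 0 1 θ - 0) ^ (k + 1)) •
      Complex.exp (ζ * circleMap 0 1 θ) =
        Complex.I * (Complex.exp (ζ * circleMap 0 1 θ) * (circleMap 0 1 θ)⁻¹ ^ k) := by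
    have : circleMap 0 1 θ ≠ 0 := circleMap_ne_center one_ne_zero
    simp only [deriv_circleMap, sub_zero, smul_eq_mul, inv_pow, pow_succ]
    field_simp
  rw [hderiv, circleIntegral] at hcauchy
  simp only [hintegrand] at hcauchy
  rw [intervalIntegral.integral_const_mul, smul_eq_mul] at hcauchy
  apply mul_left_cancel₀ Complex.I_ne_zero
  rw [hcauchy]
  ring

lemma ofReal_exp_two_mul_re_mul_circleMap (ζ : ℂ) (θ : ℝ) :
    (Real.exp (2 * (ζ * circleMap 0 1 θ).re) : ℂ) =
      Complex.exp (ζ * circleMap 0 1 θ) * Complex.exp (conj ζ * (circleMap 0 1 θ)⁻¹) := by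
  have hinv : (circleMap 0 1 θ)⁻¹ = conj (circleMap 0 1 θ) :=
    Complex.inv_eq_conj (by simp)
  rw [hinv, ← map_mul, ← Complex.exp_add, Complex.add_conj, Complex.ofReal_exp]

/-- Only the second factor of `exp (2 Re w) = exp w * exp (conj w)` is expanded: the terms are then
Cauchy integrals of the first factor. -/
lemma hasSum_intervalIntegral_exp_two_mul_re (ζ : ℂ) :
    HasSum (fun k : ℕ => 2 * π * ((‖ζ‖ ^ 2) ^ k / (k.factorial : ℝ) ^ 2))
      (∫ θ in 0..2 * π, Real.exp (2 * (ζ * circleMap 0 1 θ).re)) := by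
  have hterm (k : ℕ) : ((2 * π * ((‖ζ‖ ^ 2) ^ k / (k.factorial : ℝ) ^ 2) : ℝ) : ℂ) =
      ∫ θ in 0..2 * π, Complex.exp (ζ * circleMap 0 1 θ) *
        ((conj ζ * (circleMap 0 1 θ)⁻¹) ^ k / k.factorial) := by
    simp only [mul_pow, mul_div_right_comm _ (_ ^ k) _, mul_left_comm _ (_ / _) _]
    rw [intervalIntegral.integral_const_mul, intervalIntegral_cexp_circleMap_mul_inv_pow]
    push_cast
    rw [← Complex.mul_conj']
    ring
  have hexp (θ : ℝ) : Complex.exp (conj ζ * (circleMap 0 1 θ)⁻¹) =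
      ∑' k : ℕ, (conj ζ * (circleMap 0 1 θ)⁻¹) ^ k / k.factorial := by
    rw [Complex.exp_eq_exp_ℂ, NormedSpace.exp_eq_tsum_div]
  have hcont (k : ℕ) : Continuous fun θ : ℝ =>
      Complex.exp (ζ * circleMap 0 1 θ) * ((conj ζ * (circleMap 0 1 θ)⁻¹) ^ k / k.factorial) := by
    have hinv := (continuous_circleMap (0 : ℂ) 1).inv₀ fun θ => circleMap_ne_center one_ne_zero
    exact Continuous.mul (by fun_prop) (((continuous_const.mul hinv).pow k).div_const _)
  rw [← Complex.hasSum_ofReal, ← intervalIntegral.integral_ofReal]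
  simp only [hterm, ofReal_exp_two_mul_re_mul_circleMap, hexp, ← tsum_mul_left]
  simp only [intervalIntegral.integral_of_le Real.two_pi_pos.le]
  refine hasSum_integral_of_summable_integral_norm (fun k => (hcont k).integrableOn_Ioc) ?_
  simp only [norm_mul, norm_div, norm_pow, norm_inv, norm_circleMap_zero, RCLike.norm_conj, abs_one,
    inv_one, mul_one, Complex.norm_natCast, integral_mul_const]
  exact (Real.summable_pow_div_factorial ‖ζ‖).mul_left _

lemma lintegral_exp_two_mul_re (ζ : ℂ) :
    ∫⁻ θ in Ioo (-π) π, ENNReal.ofReal (Real.exp (2 * (ζ * circleMap 0 1 θ).re)) =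
      ∑' k : ℕ, ENNReal.ofReal (2 * π * ((‖ζ‖ ^ 2) ^ k / (k.factorial : ℝ) ^ 2)) := by
  have hcont : Continuous fun θ : ℝ => Real.exp (2 * (ζ * circleMap 0 1 θ).re) := by fun_prop
  have hperiodic : Function.Periodic
      (fun θ : ℝ => Real.exp (2 * (ζ * circleMap 0 1 θ).re)) (2 * π) := fun θ => by
    simp only [periodic_circleMap 0 1 θ]
  have hshift := hperiodic.intervalIntegral_add_eq 0 (-π)
  rw [zero_add, show -π + 2 * π = π by ring] at hshift
  have hsum := hasSum_intervalIntegral_exp_two_mul_re ζ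
  rw [hshift, intervalIntegral.integral_of_le (by linarith [Real.pi_pos]),
    integral_Ioc_eq_integral_Ioo] at hsum
  rw [← ENNReal.ofReal_tsum_of_nonneg (fun k => by positivity) hsum.summable, hsum.tsum_eq,
    ofReal_integral_eq_lintegral_ofReal]
  · exact hcont.integrableOn_Icc.mono_set Ioo_subset_Icc_self
  · exact ae_of_all _ fun θ => (Real.exp_pos _).le

end CircleIntegral

section Polar

lemma lintegral_Ioi_eq_lintegral_comp_sq (f : ℝ → ℝ≥0∞) :
    ∫⁻ u in Ioi 0, f u = ∫⁻ s in Ioi 0, ENNReal.ofReal (2 * s) * f (s ^ 2) := by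
  have himage : (fun s : ℝ => s ^ 2) '' Ioi 0 = Ioi 0 := by
    ext u
    refine ⟨?_, fun hu => ⟨√u, Real.sqrt_pos.2 hu, Real.sq_sqrt (mem_Ioi.1 hu).le⟩⟩
    rintro ⟨s, hs, rfl⟩
    exact pow_pos (mem_Ioi.1 hs) 2
  have hinj : InjOn (fun s : ℝ => s ^ 2) (Ioi 0) := fun s hs t ht hst =>
    (pow_left_inj₀ (mem_Ioi.1 hs).le (mem_Ioi.1 ht).le two_ne_zero).1 hst
  have hchange := lintegral_image_eq_lintegral_abs_deriv_mul measurableSet_Ioi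
    (fun s _ => (hasDerivAt_pow 2 s).hasDerivWithinAt) hinj f
  rw [himage] at hchange
  rw [hchange]
  refine setLIntegral_congr_fun measurableSet_Ioi fun s hs => ?_
  have hs : 0 < s := hs
  simp [abs_of_pos hs]

lemma withDensity_map_norm_sq {f : ℂ → ℝ≥0∞} (hf : Measurable f) :
    (volume.withDensity f).map (fun z => ‖z‖ ^ 2) =
      (volume.restrict (Ioi 0)).withDensity fun u : ℝ =>
        2⁻¹ * ∫⁻ θ in Ioo (-π) π, f (circleMap 0 √u θ) := by
  have hangular : Measurable fun u : ℝ => 2⁻¹ * ∫⁻ θ in Ioo (-π) π, f (circleMap 0 √u θ) := by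
    unfold circleMap
    fun_prop
  have hpolar (s θ : ℝ) : Complex.polarCoord.symm (s, θ) = circleMap 0 s θ := by
    simp [Complex.polarCoord_symm_apply, circleMap_zero, Complex.exp_mul_I]
  refine Measure.ext_of_lintegral _ fun g hg => ?_
  rw [lintegral_map hg (by fun_prop), lintegral_withDensity_eq_lintegral_mul _ hf (by fun_prop),
    lintegral_withDensity_eq_lintegral_mul _ hangular hg, lintegral_Ioi_eq_lintegral_comp_sq,
    ← Complex.lintegral_comp_polarCoord_symm, polarCoord_target, Measure.volume_eq_prod,
    ← Measure.prod_restrict, lintegral_prod _ (by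
      simp only [Complex.polarCoord_symm_apply, Pi.mul_apply, smul_eq_mul]; fun_prop)]
  refine setLIntegral_congr_fun measurableSet_Ioi fun s hs => ?_
  have hs : 0 < s := hs
  simp only [hpolar, Pi.mul_apply, smul_eq_mul, norm_circleMap_zero, sq_abs, Real.sqrt_sq hs.le]
  rw [lintegral_const_mul _ (by unfold circleMap; fun_prop),
    lintegral_mul_const _ (by unfold circleMap; fun_prop), ENNReal.ofReal_mul two_pos.le,
    ENNReal.ofReal_ofNat]
  simp only [← mul_assoc]
  rw [mul_right_comm 2, ENNReal.mul_inv_cancel two_ne_zero ENNReal.ofNat_ne_top, one_mul]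

end Polar

section CircularGaussian

/-- The circularly symmetric complex Gaussian distribution with mean `c` and power `v`, encoded by
its density; it is a probability measure for `0 < v`. -/
noncomputable def circularGaussian (c : ℂ) (v : ℝ) : Measure ℂ :=
  volume.withDensity fun z => ENNReal.ofReal (Real.exp (-(‖z - c‖ ^ 2 / v)) / (π * v))

lemma circularGaussian_map_const_add (c d : ℂ) (v : ℝ) :
    (circularGaussian d v).map (c + ·) = circularGaussian (c + d) v := by
  refine Measure.ext_of_lintegral _ fun f hf => ?_
  rw [lintegral_map hf (by fun_prop), circularGaussian, circularGaussian,
    lintegral_withDensity_eq_lintegral_mul _ (by fun_prop) (by fun_prop),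
    lintegral_withDensity_eq_lintegral_mul _ (by fun_prop) hf,
    ← lintegral_add_left_eq_self (_ * f) c]
  simp only [Pi.mul_apply, add_sub_add_left_eq_sub]

lemma gaussianReal_prod_map_measurableEquivRealProd_symm (c : ℂ) {v : NNReal} (hv : v ≠ 0) :
    ((gaussianReal c.re v).prod (gaussianReal c.im v)).map Complex.measurableEquivRealProd.symm =
      circularGaussian c (2 * v) := by
  have hmeas : Measurable fun p : ℝ × ℝ => gaussianPDF c.re v p.1 * gaussianPDF c.im v p.2 := by
    fun_prop
  have hdensity (p : ℝ × ℝ) : gaussianPDF c.re v p.1 * gaussianPDF c.im v p.2 =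
      ENNReal.ofReal (Real.exp
        (-(‖Complex.measurableEquivRealProd.symm p - c‖ ^ 2 / (2 * v))) / (π * (2 * v))) := by
    rw [gaussianPDF, gaussianPDF, ← ENNReal.ofReal_mul (gaussianPDFReal_nonneg _ _ _),
      Complex.sq_norm, Complex.normSq_apply]
    simp only [gaussianPDFReal, Complex.measurableEquivRealProd_symm_apply, Complex.sub_re,
      Complex.sub_im]
    rw [mul_mul_mul_comm, ← Real.exp_add, ← mul_inv, Real.mul_self_sqrt (by positivity)]
    ring_nf
  refine Measure.ext_of_lintegral _ fun f hf => ?_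
  rw [gaussianReal_of_var_ne_zero _ hv, gaussianReal_of_var_ne_zero _ hv,
    prod_withDensity (measurable_gaussianPDF _ _) (measurable_gaussianPDF _ _),
    lintegral_map_equiv, lintegral_withDensity_eq_lintegral_mul _ hmeas (by fun_prop),
    circularGaussian, lintegral_withDensity_eq_lintegral_mul _ (by fun_prop) hf,
    ← Complex.volume_preserving_equiv_real_prod.symm.lintegral_comp_emb
      Complex.measurableEquivRealProd.symm.measurableEmbedding, ← Measure.volume_eq_prod]
  simp only [Pi.mul_apply, hdensity]

lemma circularGaussian_eq_map_gaussianReal_prod (c : ℂ) {v : ℝ} (hv : 0 < v) :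
    circularGaussian c v = ((gaussianReal c.re (v / 2).toNNReal).prod
      (gaussianReal c.im (v / 2).toNNReal)).map Complex.measurableEquivRealProd.symm := by
  rw [gaussianReal_prod_map_measurableEquivRealProd_symm c (by simpa using hv),
    Real.coe_toNNReal _ (by positivity), mul_div_cancel₀ v two_ne_zero]

lemma isProbabilityMeasure_circularGaussian (c : ℂ) {v : ℝ} (hv : 0 < v) :
    IsProbabilityMeasure (circularGaussian c v) := by
  rw [circularGaussian_eq_map_gaussianReal_prod c hv]
  exact Measure.isProbabilityMeasure_map (by fun_prop)

end CircularGaussian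

section GammaMeasure

lemma upperGamma_nonneg (a : ℝ) {z : ℝ} (hz : 0 ≤ z) : 0 ≤ SISO.upperGamma a z :=
  setIntegral_nonneg measurableSet_Ioi fun _ ht =>
    mul_nonneg (Real.rpow_nonneg (hz.trans (mem_Ioi.1 ht).le) _) (Real.exp_pos _).le

lemma upperGamma_one (z : ℝ) : SISO.upperGamma 1 z = Real.exp (-z) := by
  simp only [SISO.upperGamma, sub_self, Real.rpow_zero, one_mul]
  exact integral_exp_neg_Ioi z

lemma gammaMeasure_natCast_add_one (r : ℝ) (k : ℕ) :
    gammaMeasure (k + 1) r = (volume.restrict (Ioi 0)).withDensity fun u =>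
      ENNReal.ofReal (r * ((r * u) ^ k * Real.exp (-(r * u)) / k.factorial)) := by
  rw [gammaMeasure, restrict_Ioi_eq_restrict_Ici, ← withDensity_indicator measurableSet_Ici]
  congr with u
  rcases le_or_gt 0 u with hu | hu
  · rw [gammaPDF_of_nonneg hu, indicator_of_mem (mem_Ici.2 hu), Real.Gamma_nat_eq_factorial,
      add_sub_cancel_right, Real.rpow_natCast, ← Nat.cast_add_one, Real.rpow_natCast]
    congr 1
    ring
  · rw [gammaPDF_of_neg hu, indicator_of_notMem (notMem_Ici.2 hu)]

lemma gammaMeasure_Ici {a r x : ℝ} (ha : 0 < a) (hr : 0 < r) (hx : 0 ≤ x) :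
    gammaMeasure a r (Ici x) = ENNReal.ofReal (SISO.upperGamma a (r * x) / Real.Gamma a) := by
  have hpdf : EqOn (gammaPDFReal a r)
      (fun u => r / Real.Gamma a * ((r * u) ^ (a - 1) * Real.exp (-(r * u)))) (Ioi x) := by
    intro u hu
    have hu : 0 < u := hx.trans_lt hu
    simp only [gammaPDFReal, if_pos hu.le, Real.mul_rpow hr.le hu.le, Real.rpow_sub_one hr.ne']
    field_simp
  have hint : IntegrableOn (fun t : ℝ => t ^ (a - 1) * Real.exp (-t)) (Ioi (r * x)) := by
    simp only [mul_comm (_ ^ (a - 1))]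
    exact (Real.GammaIntegral_convergent ha).mono_set (Ioi_subset_Ioi (by positivity))
  have hint_pdf : IntegrableOn (gammaPDFReal a r) (Ioi x) :=
    IntegrableOn.congr_fun (((integrableOn_Ioi_comp_mul_left_iff _ x hr).2 hint).const_mul _)
      hpdf.symm measurableSet_Ioi
  rw [gammaMeasure, withDensity_apply _ measurableSet_Ici, ← restrict_Ioi_eq_restrict_Ici]
  simp only [gammaPDF]
  rw [← ofReal_integral_eq_lintegral_ofReal hint_pdf (ae_of_all _ (gammaPDFReal_nonneg ha hr)),
    setIntegral_congr_fun measurableSet_Ioi hpdf, integral_const_mul,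
    integral_comp_mul_left_Ioi (fun t : ℝ => t ^ (a - 1) * Real.exp (-t)) x hr, SISO.upperGamma,
    smul_eq_mul]
  congr 1
  field_simp

lemma expMeasure_Ici {r x : ℝ} (hr : 0 < r) (hx : 0 ≤ x) :
    expMeasure r (Ici x) = ENNReal.ofReal (Real.exp (-(r * x))) := by
  rw [expMeasure, gammaMeasure_Ici one_pos hr hx, upperGamma_one, Real.Gamma_one, div_one]

lemma sFinite_gammaMeasure (a r : ℝ) : SFinite (gammaMeasure a r) := by
  unfold gammaMeasure
  infer_instance

lemma restrict_Ioi_absolutelyContinuous_gammaMeasure {a r : ℝ} (ha : 0 < a) (hr : 0 < r) :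
    volume.restrict (Ioi 0) ≪ gammaMeasure a r := by
  have hpos : ∀ᵐ u ∂volume.restrict (Ioi (0 : ℝ)), gammaPDF a r u ≠ 0 :=
    (ae_restrict_mem measurableSet_Ioi).mono fun u hu =>
      (ENNReal.ofReal_pos.2 (gammaPDFReal_pos ha hr hu)).ne'
  refine (withDensity_absolutelyContinuous' ?_ hpos).trans ?_
  · exact (measurable_gammaPDFReal a r).ennreal_ofReal.aemeasurable
  · rw [← restrict_withDensity measurableSet_Ioi]
    exact Measure.absolutelyContinuous_of_le Measure.restrict_le_self

lemma expMeasure_withDensity_poisson {r t : ℝ} (hr : 0 < r) (ht : 0 ≤ t) (k : ℕ) :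
    (expMeasure r).withDensity
        (fun u => ENNReal.ofReal (Real.exp (-(t * u)) * (t * u) ^ k / k.factorial)) =
      ENNReal.ofReal (r / (r + t) * (t / (r + t)) ^ k) • gammaMeasure (k + 1) (r + t) := by
  have hexp := gammaMeasure_natCast_add_one r 0
  rw [Nat.cast_zero, zero_add] at hexp
  rw [expMeasure, hexp, gammaMeasure_natCast_add_one, ← withDensity_mul _ (by fun_prop)
    (by fun_prop), ← withDensity_smul _ (by fun_prop)]
  refine congrArg _ (funext fun u => ?_)
  simp only [Pi.mul_apply, Pi.smul_apply, smul_eq_mul, pow_zero, one_mul, Nat.factorial_zero,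
    Nat.cast_one, div_one]
  have hexp_add : Real.exp (-((r + t) * u)) = Real.exp (-(r * u)) * Real.exp (-(t * u)) := by
    rw [← Real.exp_add]
    ring_nf
  rw [← ENNReal.ofReal_mul (by positivity), ← ENNReal.ofReal_mul (by positivity), hexp_add,
    mul_pow, mul_pow, div_pow]
  congr 1
  field_simp

end GammaMeasure

section NoncentralChiSquare

lemma norm_circleMap_sub_sq (c : ℂ) (s θ : ℝ) :
    ‖circleMap 0 s θ - c‖ ^ 2 = s ^ 2 + ‖c‖ ^ 2 - 2 * (s * conj c * circleMap 0 1 θ).re := by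
  have hscale : circleMap 0 s θ * conj c = s * conj c * circleMap 0 1 θ := by
    simp only [circleMap_zero, Complex.ofReal_one, one_mul]
    ring
  rw [Complex.sq_norm, Complex.normSq_sub, ← Complex.sq_norm, ← Complex.sq_norm,
    norm_circleMap_zero, sq_abs, hscale]

lemma lintegral_exp_neg_norm_circleMap_sub_sq_div (c : ℂ) {v : ℝ} (hv : 0 < v) (s : ℝ) :
    ∫⁻ θ in Ioo (-π) π,
        ENNReal.ofReal (Real.exp (-(‖circleMap 0 s θ - c‖ ^ 2 / v)) / (π * v)) =
      2 * ∑' k : ℕ, ENNReal.ofReal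
          (Real.exp (-(‖c‖ ^ 2 / v)) * (‖c‖ ^ 2 / v) ^ k / k.factorial) *
        ENNReal.ofReal
          (v⁻¹ * ((v⁻¹ * s ^ 2) ^ k * Real.exp (-(v⁻¹ * s ^ 2)) / k.factorial)) := by
  have hexp (θ : ℝ) : Real.exp (-(‖circleMap 0 s θ - c‖ ^ 2 / v)) / (π * v) =
      Real.exp (-(‖c‖ ^ 2 / v)) * Real.exp (-(v⁻¹ * s ^ 2)) / (π * v) *
        Real.exp (2 * ((s * conj c / v) * circleMap 0 1 θ).re) := by
    rw [div_mul_eq_mul_div, ← Real.exp_add, ← Real.exp_add, norm_circleMap_sub_sq,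
      div_mul_eq_mul_div, Complex.div_ofReal_re]
    ring_nf
  have hnorm : ‖(s * conj c / v : ℂ)‖ ^ 2 = ‖c‖ ^ 2 / v * (v⁻¹ * s ^ 2) := by
    simp only [norm_div, norm_mul, Complex.norm_real, RCLike.norm_conj, div_pow, mul_pow,
      Real.norm_eq_abs, sq_abs]
    field_simp
  simp only [hexp]
  simp only [ENNReal.ofReal_mul (show 0 ≤ Real.exp (-(‖c‖ ^ 2 / v)) *
    Real.exp (-(v⁻¹ * s ^ 2)) / (π * v) by positivity)]
  rw [lintegral_const_mul _ (by fun_prop), lintegral_exp_two_mul_re, ← ENNReal.tsum_mul_left,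
    ← ENNReal.tsum_mul_left]
  congr with k
  rw [← ENNReal.ofReal_ofNat, ← ENNReal.ofReal_mul (by positivity),
    ← ENNReal.ofReal_mul (by positivity), ← ENNReal.ofReal_mul (by positivity), hnorm, mul_pow]
  congr 1
  field_simp

theorem circularGaussian_map_norm_sq (c : ℂ) {v : ℝ} (hv : 0 < v) :
    (circularGaussian c v).map (fun z => ‖z‖ ^ 2) = Measure.sum fun k : ℕ =>
      ENNReal.ofReal (Real.exp (-(‖c‖ ^ 2 / v)) * (‖c‖ ^ 2 / v) ^ k / k.factorial) •
        gammaMeasure (k + 1) v⁻¹ := by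
  have hmeas (k : ℕ) : Measurable fun u : ℝ => ENNReal.ofReal
      (v⁻¹ * ((v⁻¹ * u) ^ k * Real.exp (-(v⁻¹ * u)) / k.factorial)) := by fun_prop
  simp only [gammaMeasure_natCast_add_one]
  rw [circularGaussian, withDensity_map_norm_sq (by fun_prop)]
  simp only [← withDensity_smul _ (hmeas _)]
  rw [← withDensity_tsum (fun k => by fun_prop)]
  refine withDensity_congr_ae ((ae_restrict_mem measurableSet_Ioi).mono fun u hu => ?_)
  simp only [lintegral_exp_neg_norm_circleMap_sub_sq_div c hv, Real.sq_sqrt (mem_Ioi.1 hu).le,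
    ← mul_assoc, ENNReal.inv_mul_cancel two_ne_zero ENNReal.ofNat_ne_top, one_mul,
    ENNReal.tsum_apply, Pi.smul_apply, smul_eq_mul]

lemma circularGaussian_zero_map_norm_sq {v : ℝ} (hv : 0 < v) :
    (circularGaussian 0 v).map (fun z => ‖z‖ ^ 2) = expMeasure v⁻¹ := by
  rw [circularGaussian_map_norm_sq 0 hv, expMeasure]
  ext s hs
  rw [Measure.sum_apply _ hs, tsum_eq_single 0 fun k hk => by simp [hk]]
  simp

end NoncentralChiSquare

section BivariateExponential

/-- The bivariate exponential distribution with unit means and correlation `ϱ ^ 2`, encoded as the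
geometric mixture of products of identical gamma distributions. It is the law of the squared moduli
of two circularly symmetric Gaussian variables of unit power whose correlation has modulus `ϱ`, and
a probability measure for `ϱ ^ 2 < 1`. -/
noncomputable def bivariateExponential (ϱ : ℝ) : Measure (ℝ × ℝ) :=
  Measure.sum fun k : ℕ => ENNReal.ofReal ((1 - ϱ ^ 2) * (ϱ ^ 2) ^ k) •
    (gammaMeasure (k + 1) (1 - ϱ ^ 2)⁻¹).prod (gammaMeasure (k + 1) (1 - ϱ ^ 2)⁻¹)

variable {ϱ : ℝ}

lemma bivariateExponential_prod (ϱ : ℝ) {S T : Set ℝ} (hS : MeasurableSet S)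
    (hT : MeasurableSet T) :
    bivariateExponential ϱ (S ×ˢ T) = ∑' k : ℕ, ENNReal.ofReal ((1 - ϱ ^ 2) * (ϱ ^ 2) ^ k) *
      (gammaMeasure (k + 1) (1 - ϱ ^ 2)⁻¹ S * gammaMeasure (k + 1) (1 - ϱ ^ 2)⁻¹ T) := by
  have hprod (k : ℕ) := sFinite_gammaMeasure (k + 1) (1 - ϱ ^ 2)⁻¹
  rw [bivariateExponential, Measure.sum_apply _ (hS.prod hT)]
  simp only [Measure.smul_apply, Measure.prod_prod, smul_eq_mul]

lemma isProbabilityMeasure_bivariateExponential (hϱ : ϱ ^ 2 < 1) :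
    IsProbabilityMeasure (bivariateExponential ϱ) := by
  have hgamma (k : ℕ) := isProbabilityMeasure_gammaMeasure k.cast_add_one_pos
    (inv_pos.2 (sub_pos.2 hϱ))
  refine ⟨?_⟩
  rw [← univ_prod_univ, bivariateExponential_prod _ .univ .univ]
  simp only [measure_univ, mul_one]
  rw [← ENNReal.ofReal_tsum_of_nonneg
      (fun k => mul_nonneg (sub_nonneg.2 hϱ.le) (pow_nonneg (sq_nonneg ϱ) k))
      ((summable_geometric_of_lt_one (sq_nonneg ϱ) hϱ).mul_left _),
    tsum_mul_left, tsum_geometric_of_lt_one (sq_nonneg ϱ) hϱ,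
    mul_inv_cancel₀ (sub_pos.2 hϱ).ne', ENNReal.ofReal_one]

lemma hasSum_bivariateExponential_Ici_prod_Ici (hϱ : ϱ ^ 2 < 1) {x y : ℝ} (hx : 0 ≤ x)
    (hy : 0 ≤ y) :
    HasSum (fun k : ℕ => (1 - ϱ ^ 2) *
        ((ϱ ^ k / k.factorial * SISO.upperGamma (k + 1) (x / (1 - ϱ ^ 2))) *
          (ϱ ^ k / k.factorial * SISO.upperGamma (k + 1) (y / (1 - ϱ ^ 2)))))
      ((bivariateExponential ϱ).real (Ici x ×ˢ Ici y)) := by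
  have hv : 0 < 1 - ϱ ^ 2 := sub_pos.2 hϱ
  have := isProbabilityMeasure_bivariateExponential hϱ
  have hsum := measure_ne_top (bivariateExponential ϱ) (Ici x ×ˢ Ici y)
  rw [bivariateExponential_prod _ measurableSet_Ici measurableSet_Ici] at hsum
  rw [measureReal_def, bivariateExponential_prod _ measurableSet_Ici measurableSet_Ici,
    ENNReal.tsum_toReal_eq fun k => ENNReal.ne_top_of_tsum_ne_top hsum k]
  convert ENNReal.hasSum_toReal hsum using 2 with k
  have hΓ {z : ℝ} (hz : 0 ≤ z) : 0 ≤ SISO.upperGamma (k + 1) (z / (1 - ϱ ^ 2)) :=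
    upperGamma_nonneg _ (div_nonneg hz hv.le)
  simp only [gammaMeasure_Ici k.cast_add_one_pos (inv_pos.2 hv), hx, hy, inv_mul_eq_div,
    Real.Gamma_nat_eq_factorial, ENNReal.toReal_mul]
  rw [ENNReal.toReal_ofReal (by positivity),
    ENNReal.toReal_ofReal (div_nonneg (hΓ hx) (by positivity)),
    ENNReal.toReal_ofReal (div_nonneg (hΓ hy) (by positivity))]
  ring

lemma bivariateExponential_prod_pos (hϱ : ϱ ^ 2 < 1) {S T : Set ℝ} (hS : MeasurableSet S)
    (hT : MeasurableSet T) (hS₀ : volume (S ∩ Ioi 0) ≠ 0) (hT₀ : volume (T ∩ Ioi 0) ≠ 0) :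
    0 < bivariateExponential ϱ (S ×ˢ T) := by
  have hv : 0 < 1 - ϱ ^ 2 := sub_pos.2 hϱ
  have hgamma {U : Set ℝ} (hU : MeasurableSet U) (hU₀ : volume (U ∩ Ioi 0) ≠ 0) :
      gammaMeasure ((0 : ℕ) + 1) (1 - ϱ ^ 2)⁻¹ U ≠ 0 := fun hzero => hU₀ <| by
    rw [← Measure.restrict_apply hU]
    exact restrict_Ioi_absolutelyContinuous_gammaMeasure (by positivity) (inv_pos.2 hv) hzero
  rw [bivariateExponential_prod _ hS hT, pos_iff_ne_zero]
  refine fun hzero => absurd (ENNReal.tsum_eq_zero.1 hzero 0) ?_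
  exact mul_ne_zero (by simpa using hϱ) (mul_ne_zero (hgamma hS hS₀) (hgamma hT hT₀))

lemma circularGaussian_setOf_norm_sq_mul_add_mem (r a : ℂ) {v : ℝ} (hv : 0 < v) {T : Set ℝ}
    (hT : MeasurableSet T) :
    circularGaussian 0 v {w | ‖r * a + w‖ ^ 2 ∈ T} = ∑' k : ℕ, ENNReal.ofReal
      (Real.exp (-(‖r‖ ^ 2 / v * ‖a‖ ^ 2)) * (‖r‖ ^ 2 / v * ‖a‖ ^ 2) ^ k / k.factorial) *
        gammaMeasure (k + 1) v⁻¹ T := by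
  have hmean : ‖r * a‖ ^ 2 / v = ‖r‖ ^ 2 / v * ‖a‖ ^ 2 := by
    rw [norm_mul, mul_pow, mul_div_right_comm]
  have hmap := circularGaussian_map_norm_sq (r * a) hv
  rw [← add_zero (r * a), ← circularGaussian_map_const_add, add_zero, hmean,
    Measure.map_map (by fun_prop) (by fun_prop)] at hmap
  have happly := congrArg (· T) hmap
  simp only [Measure.sum_apply _ hT, Measure.smul_apply, smul_eq_mul] at happly
  rw [← happly, Measure.map_apply (by fun_prop) hT]
  rfl

theorem circularGaussian_prod_map_norm_sq {r : ℂ} (hr : ‖r‖ < 1) :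
    ((circularGaussian 0 1).prod (circularGaussian 0 (1 - ‖r‖ ^ 2))).map
      (fun p => (‖p.1‖ ^ 2, ‖r * p.1 + p.2‖ ^ 2)) = bivariateExponential ‖r‖ := by
  have hv : 0 < 1 - ‖r‖ ^ 2 := by nlinarith [norm_nonneg r]
  have := isProbabilityMeasure_circularGaussian 0 one_pos
  have := isProbabilityMeasure_circularGaussian 0 hv
  have hexp := circularGaussian_zero_map_norm_sq one_pos
  rw [inv_one] at hexp
  have hrate : 1 + ‖r‖ ^ 2 / (1 - ‖r‖ ^ 2) = (1 - ‖r‖ ^ 2)⁻¹ := by field_simp; ring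
  have hweight : 1 / (1 - ‖r‖ ^ 2)⁻¹ = 1 - ‖r‖ ^ 2 := by rw [one_div, inv_inv]
  have hratio : ‖r‖ ^ 2 / (1 - ‖r‖ ^ 2) / (1 - ‖r‖ ^ 2)⁻¹ = ‖r‖ ^ 2 := by field_simp
  refine Measure.ext_prod fun {S T} hS hT => ?_
  have hmeas : Measurable fun p : ℂ × ℂ => (‖p.1‖ ^ 2, ‖r * p.1 + p.2‖ ^ 2) := by fun_prop
  have hsection (a : ℂ) : circularGaussian 0 (1 - ‖r‖ ^ 2) (Prod.mk a ⁻¹'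
      ((fun p : ℂ × ℂ => (‖p.1‖ ^ 2, ‖r * p.1 + p.2‖ ^ 2)) ⁻¹' S ×ˢ T)) =
      ((fun z => ‖z‖ ^ 2) ⁻¹' S).indicator
        (fun a => circularGaussian 0 (1 - ‖r‖ ^ 2) {w | ‖r * a + w‖ ^ 2 ∈ T}) a := by
    by_cases ha : ‖a‖ ^ 2 ∈ S <;> simp [Set.preimage, ha]
  rw [Measure.map_apply hmeas (hS.prod hT), Measure.prod_apply (hmeas (hS.prod hT)),
    bivariateExponential_prod _ hS hT]
  simp only [hsection, circularGaussian_setOf_norm_sq_mul_add_mem r _ hv hT]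
  rw [lintegral_indicator ((by fun_prop : Measurable fun z : ℂ => ‖z‖ ^ 2) hS),
    ← setLIntegral_map hS (f := fun u => ∑' k : ℕ, ENNReal.ofReal
      (Real.exp (-(‖r‖ ^ 2 / (1 - ‖r‖ ^ 2) * u)) * (‖r‖ ^ 2 / (1 - ‖r‖ ^ 2) * u) ^ k /
        k.factorial) * gammaMeasure (k + 1) (1 - ‖r‖ ^ 2)⁻¹ T) (by fun_prop) (by fun_prop),
    hexp, lintegral_tsum fun k => by fun_prop]
  congr with k
  rw [lintegral_mul_const _ (by fun_prop), ← withDensity_apply _ hS,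
    expMeasure_withDensity_poisson one_pos (by positivity), hrate, hweight, hratio,
    Measure.smul_apply, smul_eq_mul, mul_assoc]

end BivariateExponential

section ComplexGaussianVariables

variable {Ω : Type*} [MeasurableSpace Ω] {μ : Measure Ω}

lemma inner_mul_inner_eq_re_div_two (x y z w : ℂ) :
    inner ℝ x z * inner ℝ y w =
      (conj x * conj y * (z * w) + conj x * y * (z * conj w)).re / 2 := by
  simp [Complex.inner]
  ring

lemma covariance_inner_eq [IsProbabilityMeasure μ] {X Y : Ω → ℂ} (hX : MemLp X 2 μ)
    (hY : MemLp Y 2 μ) (hX₀ : ∫ ω, X ω ∂μ = 0) (x y : ℂ) :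
    cov[fun ω => inner ℝ x (X ω), fun ω => inner ℝ y (Y ω); μ] =
      (conj x * conj y * (∫ ω, X ω * Y ω ∂μ) + conj x * y * ∫ ω, X ω * conj (Y ω) ∂μ).re / 2 := by
  have hXY : Integrable (fun ω => X ω * Y ω) μ := hX.integrable_mul hY
  have hXY' : Integrable (fun ω => X ω * conj (Y ω)) μ := hX.integrable_mul hY.star
  rw [covariance_eq_sub (hX.const_inner x) (hY.const_inner y),
    integral_inner (hX.integrable one_le_two), hX₀, inner_zero_right, zero_mul, sub_zero]
  simp only [Pi.mul_apply, inner_mul_inner_eq_re_div_two]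
  rw [integral_div, ← integral_const_mul, ← integral_const_mul,
    ← integral_add (hXY.const_mul _) (hXY'.const_mul _)]
  exact congrArg (· / 2) (integral_re ((hXY.const_mul _).add (hXY'.const_mul _)))

lemma indepFun_of_uncorrelated {X Y : Ω → ℂ} (hXY : HasGaussianLaw (fun ω => (X ω, Y ω)) μ)
    (hX₀ : ∫ ω, X ω ∂μ = 0) (hpseudo : ∫ ω, X ω * Y ω ∂μ = 0)
    (hcorr : ∫ ω, X ω * conj (Y ω) ∂μ = 0) : IndepFun X Y μ := by
  have := hXY.isProbabilityMeasure
  refine hXY.indepFun_of_covariance_inner fun x y => ?_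
  rw [covariance_inner_eq hXY.fst.memLp_two hXY.snd.memLp_two hX₀, hpseudo, hcorr]
  simp

lemma map_inner_eq_gaussianReal {Z : Ω → ℂ} (hZ : HasGaussianLaw Z μ) (hmean : ∫ ω, Z ω ∂μ = 0)
    (hpseudo : ∫ ω, Z ω * Z ω ∂μ = 0) {v : ℝ} (hpower : ∫ ω, Z ω * conj (Z ω) ∂μ = v) {x : ℂ}
    (hx : ‖x‖ = 1) :
    μ.map (fun ω => inner ℝ x (Z ω)) = gaussianReal 0 (v / 2).toNNReal := by
  have := hZ.isProbabilityMeasure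
  have hinner : HasGaussianLaw (fun ω => inner ℝ x (Z ω)) μ := hZ.map_fun (innerSL ℝ x)
  rw [hinner.map_eq_gaussianReal, integral_inner hZ.integrable, hmean, inner_zero_right,
    ← covariance_self hinner.aemeasurable,
    covariance_inner_eq hZ.memLp_two hZ.memLp_two hmean, hpseudo, hpower, Complex.conj_mul', hx]
  simp

lemma map_eq_circularGaussian {Z : Ω → ℂ} (hZ : HasGaussianLaw Z μ) (hmean : ∫ ω, Z ω ∂μ = 0)
    (hpseudo : ∫ ω, Z ω * Z ω ∂μ = 0) {v : ℝ} (hv : 0 < v)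
    (hpower : ∫ ω, Z ω * conj (Z ω) ∂μ = v) :
    μ.map Z = circularGaussian 0 v := by
  have := hZ.isProbabilityMeasure
  have hre (z : ℂ) : inner ℝ 1 z = z.re := by simp [Complex.inner]
  have him (z : ℂ) : inner ℝ Complex.I z = z.im := by simp [Complex.inner]
  have hpair : HasGaussianLaw (fun ω => ((Z ω).re, (Z ω).im)) μ :=
    hZ.map_fun (Complex.equivRealProdCLM : ℂ →L[ℝ] ℝ × ℝ)
  have hindep : IndepFun (fun ω => (Z ω).re) (fun ω => (Z ω).im) μ := by
    refine hpair.indepFun_of_covariance_eq_zero ?_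
    simp only [← hre, ← him]
    rw [covariance_inner_eq hZ.memLp_two hZ.memLp_two hmean, hpseudo, hpower]
    simp
  have hmap_re := map_inner_eq_gaussianReal hZ hmean hpseudo hpower (x := 1) norm_one
  have hmap_im := map_inner_eq_gaussianReal hZ hmean hpseudo hpower Complex.norm_I
  simp only [hre] at hmap_re
  simp only [him] at hmap_im
  rw [circularGaussian_eq_map_gaussianReal_prod 0 hv, Complex.zero_re, Complex.zero_im]
  nth_rewrite 1 [← hmap_re]
  rw [← hmap_im, ← (indepFun_iff_map_prod_eq_prod_map_map hpair.fst.aemeasurable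
      hpair.snd.aemeasurable).1 hindep,
    AEMeasurable.map_map_of_aemeasurable (by fun_prop) hpair.aemeasurable]
  rfl

lemma integral_mul_sub_const_mul {X A B : Ω → ℂ} (hX : MemLp X 2 μ) (hA : MemLp A 2 μ)
    (hB : MemLp B 2 μ) (r : ℂ) :
    ∫ ω, X ω * (B ω - r * A ω) ∂μ = ∫ ω, X ω * B ω ∂μ - r * ∫ ω, X ω * A ω ∂μ := by
  have hXB : Integrable (fun ω => X ω * B ω) μ := hX.integrable_mul hB
  have hXA : Integrable (fun ω => X ω * A ω) μ := hX.integrable_mul hA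
  rw [← integral_const_mul, ← integral_sub hXB (hXA.const_mul r)]
  congr with ω
  ring

/-- `A` and `B` are centred, jointly circularly symmetric complex Gaussian variables of unit power
with correlation coefficient `E[B A^*] = r`. -/
structure IsCircularGaussianPair (μ : Measure Ω) (A B : Ω → ℂ) (r : ℂ) : Prop where
  gaussian : HasGaussianLaw (fun ω => (A ω, B ω)) μ
  mean_left : ∫ ω, A ω ∂μ = 0
  mean_right : ∫ ω, B ω ∂μ = 0
  pseudo_left : ∫ ω, A ω * A ω ∂μ = 0
  pseudo_right : ∫ ω, B ω * B ω ∂μ = 0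
  pseudo_mixed : ∫ ω, A ω * B ω ∂μ = 0
  power_left : ∫ ω, A ω * conj (A ω) ∂μ = 1
  power_right : ∫ ω, B ω * conj (B ω) ∂μ = 1
  correlation : ∫ ω, B ω * conj (A ω) ∂μ = r

namespace IsCircularGaussianPair

variable {A B : Ω → ℂ} {r : ℂ}

lemma hasGaussianLaw_innovation (hAB : IsCircularGaussianPair μ A B r) :
    HasGaussianLaw (fun ω => (A ω, B ω - r * A ω)) μ :=
  hAB.gaussian.map_fun ((ContinuousLinearMap.fst ℝ ℂ ℂ).prod
    ((ContinuousLinearMap.snd ℂ ℂ ℂ - r • ContinuousLinearMap.fst ℂ ℂ ℂ).restrictScalars ℝ))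

lemma integral_left_mul_innovation (hAB : IsCircularGaussianPair μ A B r) :
    ∫ ω, A ω * (B ω - r * A ω) ∂μ = 0 := by
  have hA := hAB.gaussian.fst.memLp_two
  rw [integral_mul_sub_const_mul hA hA hAB.gaussian.snd.memLp_two, hAB.pseudo_mixed,
    hAB.pseudo_left, mul_zero, sub_zero]

lemma integral_conj_left_mul_innovation (hAB : IsCircularGaussianPair μ A B r) :
    ∫ ω, conj (A ω) * (B ω - r * A ω) ∂μ = 0 := by
  have hA := hAB.gaussian.fst.memLp_two
  have hA' : MemLp (fun ω => conj (A ω)) 2 μ := hA.star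
  rw [integral_mul_sub_const_mul hA' hA hAB.gaussian.snd.memLp_two]
  simp only [mul_comm (conj (A _))]
  rw [hAB.correlation, hAB.power_left, mul_one, sub_self]

lemma indepFun_innovation (hAB : IsCircularGaussianPair μ A B r) :
    IndepFun A (fun ω => B ω - r * A ω) μ := by
  refine indepFun_of_uncorrelated hAB.hasGaussianLaw_innovation hAB.mean_left
    hAB.integral_left_mul_innovation ?_
  rw [← map_zero conj, ← hAB.integral_conj_left_mul_innovation, ← integral_conj]
  simp only [map_mul, Complex.conj_conj]

lemma integral_innovation (hAB : IsCircularGaussianPair μ A B r) :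
    ∫ ω, (B ω - r * A ω) ∂μ = 0 := by
  rw [integral_sub hAB.gaussian.snd.integrable (hAB.gaussian.fst.integrable.const_mul r),
    integral_const_mul, hAB.mean_left, hAB.mean_right, mul_zero, sub_zero]

lemma integral_innovation_mul_self (hAB : IsCircularGaussianPair μ A B r) :
    ∫ ω, (B ω - r * A ω) * (B ω - r * A ω) ∂μ = 0 := by
  have hA := hAB.gaussian.fst.memLp_two
  have hB := hAB.gaussian.snd.memLp_two
  rw [integral_mul_sub_const_mul hAB.hasGaussianLaw_innovation.snd.memLp_two hA hB]
  simp only [mul_comm (_ - _)]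
  rw [hAB.integral_left_mul_innovation, integral_mul_sub_const_mul hB hA hB, hAB.pseudo_right]
  simp only [mul_comm (B _)]
  rw [hAB.pseudo_mixed, mul_zero, sub_zero, sub_zero]

lemma integral_innovation_mul_conj (hAB : IsCircularGaussianPair μ A B r) :
    ∫ ω, (B ω - r * A ω) * conj (B ω - r * A ω) ∂μ = ((1 - ‖r‖ ^ 2 : ℝ) : ℂ) := by
  have hA := hAB.gaussian.fst.memLp_two
  have hB := hAB.gaussian.snd.memLp_two
  have hA' : MemLp (fun ω => conj (A ω)) 2 μ := hA.star
  have hB' : MemLp (fun ω => conj (B ω)) 2 μ := hB.star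
  have hconj : ∫ ω, A ω * conj (B ω) ∂μ = conj r := by
    rw [← hAB.correlation, ← integral_conj]
    simp only [map_mul, Complex.conj_conj, mul_comm]
  simp only [map_sub, map_mul]
  rw [integral_mul_sub_const_mul hAB.hasGaussianLaw_innovation.snd.memLp_two hA' hB']
  simp only [mul_comm (_ - _)]
  rw [hAB.integral_conj_left_mul_innovation, integral_mul_sub_const_mul hB' hA hB]
  simp only [mul_comm (conj (B _))]
  rw [hAB.power_right, hconj, Complex.mul_conj', mul_zero, sub_zero]
  push_cast
  rfl

lemma map_norm_sq (hAB : IsCircularGaussianPair μ A B r) (hr : ‖r‖ < 1) :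
    μ.map (fun ω => (‖A ω‖ ^ 2, ‖B ω‖ ^ 2)) = bivariateExponential ‖r‖ := by
  have hgauss := hAB.hasGaussianLaw_innovation
  have hv : 0 < 1 - ‖r‖ ^ 2 := by nlinarith [norm_nonneg r]
  have hleft : μ.map A = circularGaussian 0 1 :=
    map_eq_circularGaussian hAB.gaussian.fst hAB.mean_left hAB.pseudo_left one_pos
      (by rw [hAB.power_left, Complex.ofReal_one])
  have hinnovation : μ.map (fun ω => B ω - r * A ω) = circularGaussian 0 (1 - ‖r‖ ^ 2) :=
    map_eq_circularGaussian hgauss.snd hAB.integral_innovation hAB.integral_innovation_mul_self hv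
      hAB.integral_innovation_mul_conj
  have hprod := hAB.indepFun_innovation
  have := hgauss.isProbabilityMeasure
  rw [indepFun_iff_map_prod_eq_prod_map_map hgauss.fst.aemeasurable hgauss.snd.aemeasurable,
    hleft, hinnovation] at hprod
  rw [← circularGaussian_prod_map_norm_sq hr, ← hprod,
    AEMeasurable.map_map_of_aemeasurable (by fun_prop) hgauss.aemeasurable]
  simp only [Function.comp_def, add_sub_cancel]

end IsCircularGaussianPair

end ComplexGaussianVariables

section CountingEvents

variable {Ω ι : Type*} [MeasurableSpace Ω] {μ : Measure Ω}

lemma integral_card_filter [IsFiniteMeasure μ] (s : Finset ι) (P : ι → Ω → Prop)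
    [∀ i ω, Decidable (P i ω)] (hP : ∀ i ∈ s, NullMeasurableSet {ω | P i ω} μ) :
    ∫ ω, ((s.filter fun i => P i ω).card : ℝ) ∂μ = ∑ i ∈ s, μ.real {ω | P i ω} := by
  have hind (i : ι) :
      (fun ω => if P i ω then (1 : ℝ) else 0) = {ω | P i ω}.indicator fun _ => 1 := by
    ext ω
    simp only [indicator_apply, mem_ofPred_eq]
  simp only [Finset.card_filter, Nat.cast_sum, Nat.cast_ite, Nat.cast_one, Nat.cast_zero]
  rw [integral_finsetSum _ fun i hi => hind i ▸ (integrable_const 1).indicator₀ (hP i hi)]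
  refine Finset.sum_congr rfl fun i hi => ?_
  rw [hind, integral_indicator₀ (hP i hi), setIntegral_const, smul_eq_mul, mul_one]

lemma integral_card_filter_Icc_two [IsFiniteMeasure μ] (P : ℕ → Ω → Prop)
    [∀ l ω, Decidable (P l ω)] (hP : ∀ l, NullMeasurableSet {ω | P l ω} μ) {p : ℝ}
    (hp : ∀ l, 2 ≤ l → μ.real {ω | P l ω} = p) {L : ℕ} (hL : 2 ≤ L) :
    ∫ ω, (((Finset.Icc 2 L).filter fun l => P l ω).card : ℝ) ∂μ = ((L : ℝ) - 1) * p := by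
  rw [integral_card_filter _ _ fun l _ => hP l,
    Finset.sum_congr rfl fun l hl => hp l (Finset.mem_Icc.1 hl).1, Finset.sum_const,
    Nat.card_Icc, nsmul_eq_mul, Nat.add_sub_add_right L 1 1, Nat.cast_sub (by lia), Nat.cast_one]

end CountingEvents

namespace SISO

section ThresholdEvents

variable {Ω : Type*} {h : ℝ → Ω → ℂ} {Ts η Ith : ℝ} {l : ℕ} {ω : Ω}

lemma le_imi_iff (hη : 0 < η) :
    Ith ≤ imi h Ts η l ω ↔ (2 ^ Ith - 1) / η ≤ ‖h (l * Ts) ω‖ ^ 2 := by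
  rw [imi, envelope, Real.le_logb_iff_rpow_le one_lt_two (by positivity), div_le_iff₀' hη,
    sub_le_iff_le_add']

lemma imi_le_iff (hη : 0 < η) :
    imi h Ts η l ω ≤ Ith ↔ ‖h (l * Ts) ω‖ ^ 2 ≤ (2 ^ Ith - 1) / η := by
  rw [imi, envelope, Real.logb_le_iff_le_rpow one_lt_two (by positivity), le_div_iff₀' hη,
    le_sub_iff_add_le']

lemma binary_eq_one_iff_le_imi : binary h Ts η Ith l ω = 1 ↔ Ith ≤ imi h Ts η l ω := by
  simp [binary]

lemma binary_eq_zero_iff : binary h Ts η Ith l ω = 0 ↔ ¬ binary h Ts η Ith l ω = 1 := by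
  simp [binary]

lemma binary_eq_one_iff (hη : 0 < η) :
    binary h Ts η Ith l ω = 1 ↔ (2 ^ Ith - 1) / η ≤ ‖h (l * Ts) ω‖ ^ 2 :=
  binary_eq_one_iff_le_imi.trans (le_imi_iff hη)

lemma setOf_downCrossing :
    {ω | binary h Ts η Ith (l - 1) ω = 1 ∧ binary h Ts η Ith l ω = 0} =
      {ω | binary h Ts η Ith (l - 1) ω = 1} \ {ω | binary h Ts η Ith l ω = 1} := by
  simp only [binary_eq_zero_iff]
  rfl

lemma setOf_binary_ne :
    {ω | binary h Ts η Ith l ω ≠ binary h Ts η Ith (l - 1) ω} =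
      symmDiff {ω | binary h Ts η Ith l ω = 1} {ω | binary h Ts η Ith (l - 1) ω = 1} := by
  ext ω
  simp only [mem_symmDiff, mem_ofPred_eq, binary]
  split_ifs <;> simp

open Classical in
lemma crossings_eq_card_filter (L : ℕ) :
    crossings h Ts η Ith L ω = (((Finset.Icc 2 L).filter fun l =>
      binary h Ts η Ith l ω ≠ binary h Ts η Ith (l - 1) ω).card : ℝ) := by
  rw [crossings, Finset.card_filter, Nat.cast_sum]
  refine Finset.sum_congr rfl fun l _ => ?_
  unfold binary
  split_ifs <;> simp_all

lemma natCast_sub_one_mul_add (Ts : ℝ) (hl : 1 ≤ l) : ((l - 1 : ℕ) : ℝ) * Ts + Ts = l * Ts := by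
  rw [Nat.cast_sub hl]
  push_cast
  ring

lemma two_rpow_sub_one_div_nonneg (hη : 0 < η) (hI : 0 ≤ Ith) : 0 ≤ ((2 : ℝ) ^ Ith - 1) / η :=
  div_nonneg (sub_nonneg.2 (Real.one_le_rpow one_le_two hI)) hη.le

lemma two_rpow_sub_one_div_pos (hη : 0 < η) (hI : 0 < Ith) : 0 < ((2 : ℝ) ^ Ith - 1) / η :=
  div_pos (sub_pos.2 (Real.one_lt_rpow one_lt_two hI)) hη

end ThresholdEvents

namespace IsRayleighChannel

variable {Ω : Type*} [MeasurableSpace Ω] {μ : Measure Ω} {h : ℝ → Ω → ℂ} {ρ : ℝ → ℂ}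

lemma integral_mul_conj_self (hh : IsRayleighChannel μ h ρ) (t : ℝ) :
    ∫ ω, h t ω * conj (h t ω) ∂μ = 1 := by
  have hcorr := hh.correlation t 0
  rwa [sub_zero, hh.unit_power] at hcorr

lemma isCircularGaussianPair (hh : IsRayleighChannel μ h ρ) (s τ : ℝ) :
    IsCircularGaussianPair μ (h s) (h (s + τ)) (ρ τ) where
  gaussian := hh.gaussian.hasGaussianLaw_prodMk
  mean_left := hh.zero_mean s
  mean_right := hh.zero_mean (s + τ)
  pseudo_left := hh.circular s s
  pseudo_right := hh.circular (s + τ) (s + τ)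
  pseudo_mixed := hh.circular s (s + τ)
  power_left := hh.integral_mul_conj_self s
  power_right := hh.integral_mul_conj_self (s + τ)
  correlation := by simpa only [add_sub_cancel_right] using hh.correlation (s + τ) τ

lemma aemeasurable_norm_sq (hh : IsRayleighChannel μ h ρ) (t : ℝ) :
    AEMeasurable (fun ω => ‖h t ω‖ ^ 2) μ :=
  (hh.gaussian.aemeasurable t).norm.pow_const 2

lemma map_norm_sq (hh : IsRayleighChannel μ h ρ) (t : ℝ) :
    μ.map (fun ω => ‖h t ω‖ ^ 2) = expMeasure 1 := by
  have hmap : μ.map (h t) = circularGaussian 0 1 :=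
    map_eq_circularGaussian (hh.gaussian.hasGaussianLaw_eval t) (hh.zero_mean t) (hh.circular t t)
      one_pos (by rw [hh.integral_mul_conj_self, Complex.ofReal_one])
  have hexp := circularGaussian_zero_map_norm_sq one_pos
  rwa [inv_one, ← hmap, AEMeasurable.map_map_of_aemeasurable (by fun_prop)
    (hh.gaussian.aemeasurable t)] at hexp

lemma measureReal_norm_sq_le (hh : IsRayleighChannel μ h ρ) (t : ℝ) {x : ℝ} (hx : 0 ≤ x) :
    μ.real {ω | ‖h t ω‖ ^ 2 ≤ x} = 1 - Real.exp (-x) := by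
  have := isProbabilityMeasure_expMeasure one_pos
  have hcdf := cdf_expMeasure_eq one_pos x
  rwa [cdf_eq_real, ← hh.map_norm_sq t,
    map_measureReal_apply_of_aemeasurable (hh.aemeasurable_norm_sq t) measurableSet_Iic, if_pos hx,
    one_mul] at hcdf

lemma measureReal_le_norm_sq (hh : IsRayleighChannel μ h ρ) (t : ℝ) {x : ℝ} (hx : 0 ≤ x) :
    μ.real {ω | x ≤ ‖h t ω‖ ^ 2} = Real.exp (-x) := by
  have htail := congrArg (fun ν => ν.real (Ici x)) (hh.map_norm_sq t)
  simp only [map_measureReal_apply_of_aemeasurable (hh.aemeasurable_norm_sq t)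
    measurableSet_Ici] at htail
  refine htail.trans ?_
  rw [measureReal_def, expMeasure_Ici one_pos hx, one_mul,
    ENNReal.toReal_ofReal (Real.exp_pos _).le]

variable {Ts η Ith : ℝ} {l L : ℕ}

lemma imiCDF_eq (hh : IsRayleighChannel μ h ρ) (hη : 0 < η) (hI : 0 ≤ Ith) (l : ℕ) :
    imiCDF μ h Ts η l Ith = 1 - Real.exp (-((2 ^ Ith - 1) / η)) := by
  simp only [imiCDF, imi_le_iff hη]
  exact hh.measureReal_norm_sq_le _ (two_rpow_sub_one_div_nonneg hη hI)

lemma measureReal_binary_eq_one (hh : IsRayleighChannel μ h ρ) (hη : 0 < η) (hI : 0 ≤ Ith)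
    (l : ℕ) :
    μ.real {ω | binary h Ts η Ith l ω = 1} = Real.exp (-((2 ^ Ith - 1) / η)) := by
  simp only [binary_eq_one_iff hη]
  exact hh.measureReal_le_norm_sq _ (two_rpow_sub_one_div_nonneg hη hI)

lemma nullMeasurableSet_binary_eq_one (hh : IsRayleighChannel μ h ρ) (hη : 0 < η) (l : ℕ) :
    NullMeasurableSet {ω | binary h Ts η Ith l ω = 1} μ := by
  simp only [binary_eq_one_iff hη]
  exact nullMeasurableSet_le aemeasurable_const (hh.aemeasurable_norm_sq _)

lemma measureReal_consecutive_norm_sq_mem (hh : IsRayleighChannel μ h ρ) (hρ : ‖ρ Ts‖ < 1)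
    (hl : 1 ≤ l) {S T : Set ℝ} (hS : MeasurableSet S) (hT : MeasurableSet T) :
    μ.real {ω | ‖h ((l - 1 : ℕ) * Ts) ω‖ ^ 2 ∈ S ∧ ‖h (l * Ts) ω‖ ^ 2 ∈ T} =
      (bivariateExponential ‖ρ Ts‖).real (S ×ˢ T) := by
  have hpair := hh.isCircularGaussianPair ((l - 1 : ℕ) * Ts) Ts
  rw [natCast_sub_one_mul_add Ts hl] at hpair
  rw [← hpair.map_norm_sq hρ, map_measureReal_apply_of_aemeasurable
    ((hh.aemeasurable_norm_sq _).prodMk (hh.aemeasurable_norm_sq _)) (hS.prod hT)]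
  rfl

lemma measureReal_consecutive_binary_eq_one (hh : IsRayleighChannel μ h ρ) (hη : 0 < η)
    (hρ : ‖ρ Ts‖ < 1) (hl : 1 ≤ l) :
    μ.real {ω | binary h Ts η Ith l ω = 1 ∧ binary h Ts η Ith (l - 1) ω = 1} =
      (bivariateExponential ‖ρ Ts‖).real
        (Ici ((2 ^ Ith - 1) / η) ×ˢ Ici ((2 ^ Ith - 1) / η)) := by
  rw [← hh.measureReal_consecutive_norm_sq_mem hρ hl measurableSet_Ici measurableSet_Ici]
  simp only [binary_eq_one_iff hη, mem_Ici, and_comm]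

lemma measureReal_downCrossing_pos (hh : IsRayleighChannel μ h ρ) (hη : 0 < η) (hI : 0 < Ith)
    (hρ : ‖ρ Ts‖ < 1) (hl : 1 ≤ l) :
    0 < μ.real {ω | binary h Ts η Ith (l - 1) ω = 1 ∧ binary h Ts η Ith l ω = 0} := by
  have hϱ : ‖ρ Ts‖ ^ 2 < 1 := pow_lt_one₀ (norm_nonneg _) hρ two_ne_zero
  have hx := two_rpow_sub_one_div_pos hη hI
  have := isProbabilityMeasure_bivariateExponential hϱ
  have hevent : {ω | binary h Ts η Ith (l - 1) ω = 1 ∧ binary h Ts η Ith l ω = 0} =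
      {ω | ‖h ((l - 1 : ℕ) * Ts) ω‖ ^ 2 ∈ Ici ((2 ^ Ith - 1) / η) ∧
        ‖h (l * Ts) ω‖ ^ 2 ∈ Iio ((2 ^ Ith - 1) / η)} := by
    simp only [binary_eq_zero_iff, binary_eq_one_iff hη, not_le, mem_Ici, mem_Iio]
  rw [hevent, hh.measureReal_consecutive_norm_sq_mem hρ hl measurableSet_Ici measurableSet_Iio]
  refine ENNReal.toReal_pos (bivariateExponential_prod_pos hϱ measurableSet_Ici measurableSet_Iio
    ?_ ?_).ne' (measure_ne_top _ _)
  · rw [inter_eq_left.2 (Ici_subset_Ioi.2 hx), Real.volume_Ici]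
    exact ENNReal.top_ne_zero
  · rw [Iio_inter_Ioi, Real.volume_Ioo, sub_zero]
    exact (ENNReal.ofReal_pos.2 hx).ne'

variable [IsProbabilityMeasure μ]

lemma measureReal_upCrossing (hh : IsRayleighChannel μ h ρ) (hη : 0 < η) (l : ℕ) :
    μ.real ({ω | binary h Ts η Ith l ω = 1} \ {ω | binary h Ts η Ith (l - 1) ω = 1}) =
      μ.real {ω | binary h Ts η Ith l ω = 1} -
        μ.real {ω | binary h Ts η Ith l ω = 1 ∧ binary h Ts η Ith (l - 1) ω = 1} :=
  eq_sub_of_add_eq' (measureReal_inter_add_sdiff₀ (hh.nullMeasurableSet_binary_eq_one hη (l - 1)))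

lemma measureReal_downCrossing (hh : IsRayleighChannel μ h ρ) (hη : 0 < η) (hI : 0 ≤ Ith)
    (l : ℕ) :
    μ.real {ω | binary h Ts η Ith (l - 1) ω = 1 ∧ binary h Ts η Ith l ω = 0} =
      μ.real {ω | binary h Ts η Ith l ω = 1} -
        μ.real {ω | binary h Ts η Ith l ω = 1 ∧ binary h Ts η Ith (l - 1) ω = 1} := by
  have hstationary : μ.real {ω | binary h Ts η Ith (l - 1) ω = 1} =
      μ.real {ω | binary h Ts η Ith l ω = 1} := by
    rw [hh.measureReal_binary_eq_one hη hI, hh.measureReal_binary_eq_one hη hI]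
  rw [← hstationary, setOf_downCrossing]
  refine eq_sub_of_add_eq' ?_
  simp only [and_comm (a := binary h Ts η Ith l _ = 1)]
  exact measureReal_inter_add_sdiff₀ (hh.nullMeasurableSet_binary_eq_one hη l)

lemma integral_downCrossings (hh : IsRayleighChannel μ h ρ) (hη : 0 < η) (hI : 0 ≤ Ith)
    (hρ : ‖ρ Ts‖ < 1) (hL : 2 ≤ L) :
    ∫ ω, (downCrossings h Ts η Ith L ω : ℝ) ∂μ =
      ((L : ℝ) - 1) * (Real.exp (-((2 ^ Ith - 1) / η)) - (bivariateExponential ‖ρ Ts‖).real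
        (Ici ((2 ^ Ith - 1) / η) ×ˢ Ici ((2 ^ Ith - 1) / η))) := by
  refine integral_card_filter_Icc_two _ (fun l => ?_) (fun l hl => ?_) hL
  · rw [setOf_downCrossing]
    exact (hh.nullMeasurableSet_binary_eq_one hη (l - 1)).diff
      (hh.nullMeasurableSet_binary_eq_one hη l)
  · rw [hh.measureReal_downCrossing hη hI, hh.measureReal_binary_eq_one hη hI,
      hh.measureReal_consecutive_binary_eq_one hη hρ (one_le_two.trans hl)]

lemma integral_crossings (hh : IsRayleighChannel μ h ρ) (hη : 0 < η) (hI : 0 ≤ Ith) (L : ℕ) :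
    ∫ ω, crossings h Ts η Ith L ω ∂μ = 2 * ∫ ω, (downCrossings h Ts η Ith L ω : ℝ) ∂μ := by
  classical
  have hmeas (l : ℕ) : NullMeasurableSet {ω | binary h Ts η Ith l ω = 1} μ :=
    hh.nullMeasurableSet_binary_eq_one hη l
  have hcrossing (l : ℕ) : μ.real {ω | binary h Ts η Ith l ω ≠ binary h Ts η Ith (l - 1) ω} =
      2 * μ.real {ω | binary h Ts η Ith (l - 1) ω = 1 ∧ binary h Ts η Ith l ω = 0} := by
    rw [setOf_binary_ne, Set.symmDiff_def, measureReal_union₀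
        ((hmeas (l - 1)).diff (hmeas l)) disjoint_sdiff_sdiff.aedisjoint,
      hh.measureReal_upCrossing hη, ← hh.measureReal_downCrossing hη hI, ← setOf_downCrossing,
      two_mul]
  simp only [crossings_eq_card_filter, downCrossings]
  rw [integral_card_filter _ (fun l ω => binary h Ts η Ith l ω ≠ binary h Ts η Ith (l - 1) ω)
      fun l _ => setOf_binary_ne ▸ (hmeas l).symmDiff (hmeas (l - 1)),
    integral_card_filter _ (fun l ω => binary h Ts η Ith (l - 1) ω = 1 ∧ binary h Ts η Ith l ω = 0)
      fun l _ => setOf_downCrossing ▸ (hmeas (l - 1)).diff (hmeas l), Finset.mul_sum]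
  exact Finset.sum_congr rfl fun l _ => hcrossing l

lemma integral_outageTime (hh : IsRayleighChannel μ h ρ) (hη : 0 < η) (hI : 0 ≤ Ith)
    (hL : 2 ≤ L) :
    ∫ ω, outageTime h Ts η Ith L ω ∂μ =
      Ts * (((L : ℝ) - 1) * (1 - Real.exp (-((2 ^ Ith - 1) / η)))) := by
  simp only [outageTime, ← not_le, ← binary_eq_one_iff_le_imi]
  rw [integral_const_mul]
  congr 1
  refine integral_card_filter_Icc_two _ (fun l => ?_) (fun l _ => ?_) hL
  · exact (hh.nullMeasurableSet_binary_eq_one hη l).compl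
  · exact (probReal_compl_eq_one_sub₀ (hh.nullMeasurableSet_binary_eq_one hη l)).trans (by
      rw [hh.measureReal_binary_eq_one hη hI])

lemma lcr_eq (hh : IsRayleighChannel μ h ρ) (hη : 0 < η) (hI : 0 ≤ Ith) (hρ : ‖ρ Ts‖ < 1)
    (hL : 2 ≤ L) :
    lcr μ h Ts η Ith L =
      (Real.exp (-((2 ^ Ith - 1) / η)) - (bivariateExponential ‖ρ Ts‖).real
        (Ici ((2 ^ Ith - 1) / η) ×ˢ Ici ((2 ^ Ith - 1) / η))) / Ts := by
  have hL₁ : (L : ℝ) - 1 ≠ 0 := (sub_pos.2 (Nat.one_lt_cast.2 hL)).ne'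
  rw [lcr, hh.integral_downCrossings hη hI hρ hL, mul_div_mul_left _ _ hL₁]

lemma lcr_eq_measureReal_sub (hh : IsRayleighChannel μ h ρ) (hη : 0 < η) (hI : 0 ≤ Ith)
    (hρ : ‖ρ Ts‖ < 1) (hL : 2 ≤ L) (hl : 1 ≤ l) :
    lcr μ h Ts η Ith L =
      (μ.real {ω | binary h Ts η Ith l ω = 1} -
        μ.real {ω | binary h Ts η Ith l ω = 1 ∧ binary h Ts η Ith (l - 1) ω = 1}) / Ts := by
  rw [hh.lcr_eq hη hI hρ hL, hh.measureReal_binary_eq_one hη hI,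
    hh.measureReal_consecutive_binary_eq_one hη hρ hl]

lemma lcr_pos (hh : IsRayleighChannel μ h ρ) (hTs : 0 < Ts) (hη : 0 < η) (hI : 0 < Ith)
    (hρ : ‖ρ Ts‖ < 1) (hL : 2 ≤ L) : 0 < lcr μ h Ts η Ith L := by
  rw [hh.lcr_eq_measureReal_sub hη hI.le hρ hL le_rfl, ← hh.measureReal_downCrossing hη hI.le]
  exact div_pos (hh.measureReal_downCrossing_pos hη hI hρ le_rfl) hTs

lemma crossingRate_eq_two_mul_lcr (hh : IsRayleighChannel μ h ρ) (hη : 0 < η) (hI : 0 ≤ Ith)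
    (L : ℕ) : crossingRate μ h Ts η Ith L = 2 * lcr μ h Ts η Ith L := by
  rw [crossingRate, hh.integral_crossings hη hI, lcr, mul_div_assoc]

lemma aod_div_eq_imiCDF_div (hh : IsRayleighChannel μ h ρ) (hTs : 0 < Ts) (hη : 0 < η)
    (hI : 0 ≤ Ith) (hL : 2 ≤ L) (l : ℕ) :
    aod μ h Ts η Ith L / Ts = imiCDF μ h Ts η l Ith / (Ts * lcr μ h Ts η Ith L) := by
  have hL₁ : (L : ℝ) - 1 ≠ 0 := (sub_pos.2 (Nat.one_lt_cast.2 hL)).ne'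
  rw [aod, hh.integral_outageTime hη hI hL, ← hh.imiCDF_eq (Ts := Ts) hη hI l, lcr]
  field_simp

end IsRayleighChannel

end SISO

theorem mainTheorem2 {Ω : Type*} [MeasurableSpace Ω] (μ : Measure Ω) [IsProbabilityMeasure μ]
    (h : ℝ → Ω → ℂ) (ρ : ℝ → ℂ) (hh : SISO.IsRayleighChannel μ h ρ)
    (Ts η Ith : ℝ) (hTs : 0 < Ts) (hη : 0 < η) (hI : 0 ≤ Ith)
    (ϱ₁ : ℝ) (hϱ₁ : ϱ₁ = ‖ρ Ts‖) (hlt : ϱ₁ < 1) :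
    -- the series in the formula converges
    Summable (fun k : ℕ =>
      (ϱ₁ ^ k / (k.factorial : ℝ) *
        SISO.upperGamma ((k : ℝ) + 1) ((2 ^ Ith - 1) / (η * (1 - ϱ₁ ^ 2)))) ^ 2) ∧
    -- the level-crossing rate
    (∀ L : ℕ, 2 ≤ L →
      SISO.lcr μ h Ts η Ith L =
        (Real.exp (-((2 ^ Ith - 1) / η)) -
          (1 - ϱ₁ ^ 2) * ∑' k : ℕ,
            (ϱ₁ ^ k / (k.factorial : ℝ) *
              SISO.upperGamma ((k : ℝ) + 1) ((2 ^ Ith - 1) / (η * (1 - ϱ₁ ^ 2)))) ^ 2) / Ts ∧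
      SISO.crossingRate μ h Ts η Ith L = 2 * SISO.lcr μ h Ts η Ith L ∧
      ∀ l : ℕ, 2 ≤ l →
        SISO.lcr μ h Ts η Ith L =
          (μ.real {ω | SISO.binary h Ts η Ith l ω = 1} -
            μ.real {ω | SISO.binary h Ts η Ith l ω = 1 ∧
              SISO.binary h Ts η Ith (l - 1) ω = 1}) / Ts) ∧
    -- the cumulative distribution function
    (∀ l : ℕ, 1 ≤ l →
      SISO.imiCDF μ h Ts η l Ith = 1 - Real.exp (-((2 ^ Ith - 1) / η))) ∧
    -- the average outage duration, at a positive threshold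
    (0 < Ith → ∀ L : ℕ, 2 ≤ L →
      0 < SISO.lcr μ h Ts η Ith L ∧
      (∀ l : ℕ, 1 ≤ l →
        SISO.aod μ h Ts η Ith L / Ts =
          SISO.imiCDF μ h Ts η l Ith / (Ts * SISO.lcr μ h Ts η Ith L)) ∧
      SISO.aod μ h Ts η Ith L / Ts =
        (1 - Real.exp (-((2 ^ Ith - 1) / η))) /
          (Real.exp (-((2 ^ Ith - 1) / η)) -
            (1 - ϱ₁ ^ 2) * ∑' k : ℕ,
              (ϱ₁ ^ k / (k.factorial : ℝ) *
                SISO.upperGamma ((k : ℝ) + 1)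
                  ((2 ^ Ith - 1) / (η * (1 - ϱ₁ ^ 2)))) ^ 2)) := by
  subst hϱ₁
  have hϱ : ‖ρ Ts‖ ^ 2 < 1 := pow_lt_one₀ (norm_nonneg _) hlt two_ne_zero
  have hx := SISO.two_rpow_sub_one_div_nonneg hη hI
  have hjoint := hasSum_bivariateExponential_Ici_prod_Ici hϱ hx hx
  simp only [← sq, div_div] at hjoint
  simp only [← tsum_mul_left, hjoint.tsum_eq]
  refine ⟨(summable_mul_left_iff (sub_pos.2 hϱ).ne').1 hjoint.summable,
    fun L hL => ⟨hh.lcr_eq hη hI hlt hL, hh.crossingRate_eq_two_mul_lcr hη hI L,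
      fun l hl => hh.lcr_eq_measureReal_sub hη hI hlt hL (one_le_two.trans hl)⟩,
    fun l _ => hh.imiCDF_eq hη hI l,
    fun hI' L hL => ⟨hh.lcr_pos hTs hη hI' hlt hL,
      fun l _ => hh.aod_div_eq_imiCDF_div hTs hη hI hL l, ?_⟩⟩
  rw [hh.aod_div_eq_imiCDF_div hTs hη hI hL 1, hh.imiCDF_eq hη hI, hh.lcr_eq hη hI hlt hL,
    mul_div_cancel₀ _ hTs.ne']
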